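/- All graphs are finite, simple and undirected. A \emph{cactus} is a connected graph in which every edge belongs to at most one simple cycle. A vertex set $S \subseteq V(G)$ of a connected graph $G$ is a \emph{strong geodetic set} if one can assign to each unordered pair of vertices of $S$ a single shortest path between them in such a way that every vertex of $V(G) \setminus S$ lies on one of the assigned paths. The problem \textsc{Strong Geodetic Recognition} (SGR) asks, given a graph $G$ and a set $S \subseteq V(G)$, whether $S$ is a strong geodetic set of $G$. \textbf{Corollary.} There is a polynomial-time algorithm that solves SGR on cactus graphs: there are an algorithm and a polynomial $p$ such that, for every cactus $G$ and every $S \subseteq V(G)$, the algorithm, given $(G,S)$ (encoded as a bit string of length $N$, by the adjacency matrix of $G$ and the characteristic vector of $S$), halts after at most $p(N)$ steps and accepts if and only if $S$ is a strong geodetic set of $G$. -/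

import Mathlib

/-! ### Graphs -/

/-- A cactus: a connected graph in which every edge belongs to at most one simple cycle.
Two closed walks that are cycles represent the same simple cycle iff they have the same edges. -/
def IsCactus {V : Type*} (G : SimpleGraph V) : Prop :=
  G.Connected ∧
    ∀ (u v : V) (p : G.Walk u u) (q : G.Walk v v), p.IsCycle → q.IsCycle →
      ∀ e : Sym2 V, e ∈ p.edges → e ∈ q.edges → ∀ f : Sym2 V, f ∈ p.edges ↔ f ∈ q.edges

/-- `S` is a strong geodetic set of `G`: one can fix one shortest path for each unordered pair of
vertices of `S` so that the fixed paths cover all vertices outside `S`. The second condition says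
that the pairs `(u, v)` and `(v, u)` receive the same path; a pair `(u, u)` receives the path of
length `0`, which covers nothing outside `S`. -/
def IsStrongGeodetic {V : Type*} (G : SimpleGraph V) (S : Finset V) : Prop :=
  ∃ P : ∀ u v : S, G.Walk (u : V) (v : V),
    (∀ u v : S, (P u v).length = G.dist (u : V) (v : V)) ∧
    (∀ u v : S, P v u = (P u v).reverse) ∧
    ∀ w : V, w ∉ S → ∃ u v : S, w ∈ (P u v).support

/-! ### Random access machines -/

namespace RAM

/-- Programs of a random access machine with registers and a memory, all of whose cells hold
natural numbers. A program mentions only finitely many registers; the memory is accessed by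
indirect addressing. -/
inductive Prog : Type
  | skip : Prog
  /-- `R[r] := c` -/
  | const (r c : ℕ) : Prog
  /-- `R[r] := R[a] + R[b]` -/
  | add (r a b : ℕ) : Prog
  /-- `R[r] := max (R[a] - R[b]) 0` -/
  | sub (r a b : ℕ) : Prog
  /-- `R[r] := M[R[a]]` -/
  | load (r a : ℕ) : Prog
  /-- `M[R[a]] := R[r]` -/
  | store (a r : ℕ) : Prog
  | seq (c d : Prog) : Prog
  /-- if `R[r] ≠ 0` then `c` else `d` -/
  | ite (r : ℕ) (c d : Prog) : Prog
  /-- while `R[r] ≠ 0` do `c` -/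
  | loop (r : ℕ) (c : Prog) : Prog

/-- The contents of the registers and of the memory. -/
structure State where
  reg : ℕ → ℕ
  mem : ℕ → ℕ

/-- `s.setReg r x` is `s` with register `r` overwritten by `x`. -/
def State.setReg (s : State) (r x : ℕ) : State :=
  ⟨Function.update s.reg r x, s.mem⟩

/-- `s.setMem a x` is `s` with memory cell `a` overwritten by `x`. -/
def State.setMem (s : State) (a x : ℕ) : State :=
  ⟨s.reg, Function.update s.mem a x⟩

/-- `Exec c s s' t`: started in state `s`, the program `c` halts in state `s'` after exactly `t`
steps. Every elementary instruction and every test takes one step. -/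
inductive Exec : Prog → State → State → ℕ → Prop
  | skip (s : State) : Exec .skip s s 1
  | const (s : State) (r c : ℕ) : Exec (.const r c) s (s.setReg r c) 1
  | add (s : State) (r a b : ℕ) : Exec (.add r a b) s (s.setReg r (s.reg a + s.reg b)) 1
  | sub (s : State) (r a b : ℕ) : Exec (.sub r a b) s (s.setReg r (s.reg a - s.reg b)) 1
  | load (s : State) (r a : ℕ) : Exec (.load r a) s (s.setReg r (s.mem (s.reg a))) 1
  | store (s : State) (a r : ℕ) : Exec (.store a r) s (s.setMem (s.reg a) (s.reg r)) 1
  | seq {c d : Prog} {s s₁ s₂ : State} {t₁ t₂ : ℕ} :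
      Exec c s s₁ t₁ → Exec d s₁ s₂ t₂ → Exec (.seq c d) s s₂ (t₁ + t₂)
  | iteTrue {r : ℕ} {c d : Prog} {s s₁ : State} {t : ℕ} :
      s.reg r ≠ 0 → Exec c s s₁ t → Exec (.ite r c d) s s₁ (t + 1)
  | iteFalse {r : ℕ} {c d : Prog} {s s₁ : State} {t : ℕ} :
      s.reg r = 0 → Exec d s s₁ t → Exec (.ite r c d) s s₁ (t + 1)
  | loopDone {r : ℕ} {c : Prog} {s : State} :
      s.reg r = 0 → Exec (.loop r c) s s 1
  | loopStep {r : ℕ} {c : Prog} {s s₁ s₂ : State} {t₁ t₂ : ℕ} :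
      s.reg r ≠ 0 → Exec c s s₁ t₁ → Exec (.loop r c) s₁ s₂ t₂ →
        Exec (.loop r c) s s₂ (t₁ + t₂ + 1)

/-- The initial state for the input word `w`: memory cell `i` holds the `i`-th bit of `w` (and `0`
beyond the end), register `0` holds the length of `w`, all other registers hold `0`. -/
def input (w : List Bool) : State :=
  ⟨fun r => if r = 0 then w.length else 0, fun i => (w.getD i false).toNat⟩

/-- The problem of deciding `yes`, restricted to the instances in `dom` and with instances encoded
as bit strings by `enc`, is solvable in polynomial time: some program halts on every instance in
`dom` within a number of steps that is polynomial in the length of the encoding, and accepts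
(register `0` is nonzero at the end) exactly the instances in `yes`. -/
def SolvableInPolyTime {α : Type*} (enc : α → List Bool) (dom yes : α → Prop) : Prop :=
  ∃ (c : Prog) (p : Polynomial ℕ), ∀ x : α, dom x →
    ∃ (s : State) (t : ℕ), Exec c (input (enc x)) s t ∧ t ≤ p.eval (enc x).length ∧
      (s.reg 0 ≠ 0 ↔ yes x)

end RAM

/-! ### The recognition problem -/

/-- An instance of Strong Geodetic Recognition: a finite graph, with vertices numbered
`0, …, n - 1`, and a set of its vertices. -/
structure SGRInstance where
  n : ℕ
  G : SimpleGraph (Fin n)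
  S : Finset (Fin n)

open Classical in
/-- The encoding of an instance: `n` in unary, closed by a `false`, followed by the adjacency matrix
row by row and by the characteristic vector of the vertex set. -/
noncomputable def SGRInstance.encode (I : SGRInstance) : List Bool :=
  List.replicate I.n true ++ [false] ++
    ((List.finRange I.n).flatMap fun i => (List.finRange I.n).map fun j => decide (I.G.Adj i j)) ++
    (List.finRange I.n).map fun i => decide (i ∈ I.S)

/-! In a cactus, strong geodeticity reduces to a condition on distances. If `S` has at most two
elements, at most one assigned path can cover anything, so it must pass through every vertex: some
pair of `S` has distance one less than the order of the graph. If `S` has at least three elements,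
it suffices that each vertex outside `S` lies on some geodesic between elements of `S`; the paths
can then be chosen compatibly.

For the second claim, choose geodesics leaving as few vertices uncovered as possible. If `w` is
uncovered but lies on a geodesic from `u` to `v`, reroute the path of this pair along a detour
through `w`. By minimality some `x` on the replaced arc becomes uncovered. The two arcs form a
cycle, and in a cactus their interior vertices `x` and `w` together separate the common ends of the
arcs (`IsCactus.mem_support_or_mem_support`). But a third element `z` of `S` gives a walk `u`, `z`,
`v` along unchanged paths, which must meet `x` or `w`: either `x` is still covered or `w` was
covered before, a contradiction. The criterion is `IsCactus.isStrongGeodetic_iff`.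

The criterion needs only a distance table, computed by breadth-first rounds. The procedure is
written in a small language whose loops and sums range below the input length, so that every program
compiles to a machine program with a polynomial time bound (`Expr.compile_spec`,
`Stmt.compile_spec`). Its correctness is `distances_run` and `eval_accept`. -/

namespace RAM

/-! ### A language of bounded arithmetic and its compilation -/

/-- Arithmetic expressions over the memory. Variables are named by natural numbers, and summation
ranges over the numbers below the input length. -/
inductive Expr : Type
  | num (c : ℕ) : Expr
  | size : Expr
  | var (x : ℕ) : Expr
  | add (a b : Expr) : Expr
  | sub (a b : Expr) : Expr
  | load (a : Expr) : Expr
  | cond (a b c : Expr) : Expr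
  | sum (x : ℕ) (a : Expr) : Expr

/-- The value of an expression for input length `N`, environment `ρ` and memory `m`. -/
def Expr.eval (N : ℕ) : Expr → (ℕ → ℕ) → (ℕ → ℕ) → ℕ
  | num c, _, _ => c
  | size, _, _ => N
  | var x, ρ, _ => ρ x
  | add a b, ρ, m => a.eval N ρ m + b.eval N ρ m
  | sub a b, ρ, m => a.eval N ρ m - b.eval N ρ m
  | load a, ρ, m => m (a.eval N ρ m)
  | cond a b c, ρ, m => if a.eval N ρ m ≠ 0 then b.eval N ρ m else c.eval N ρ m
  | sum x a, ρ, m => ∑ i ∈ Finset.range N, a.eval N (Function.update ρ x i) m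

/-- `e.compile σ r` evaluates `e` into register `r`, where the variable `x` is held in
register `σ x`, and registers from `r` on are free. -/
def Expr.compile : Expr → (ℕ → ℕ) → ℕ → Prog
  | num c, _, r => .const r c
  | size, _, r => .seq (.const r 0) (.add r 0 r)
  | var x, σ, r => .seq (.const r 0) (.add r (σ x) r)
  | add a b, σ, r => .seq (a.compile σ r) (.seq (b.compile σ (r + 1)) (.add r r (r + 1)))
  | sub a b, σ, r => .seq (a.compile σ r) (.seq (b.compile σ (r + 1)) (.sub r r (r + 1)))
  | load a, σ, r => .seq (a.compile σ r) (.load r r)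
  | cond a b c, σ, r => .seq (a.compile σ r) (.ite r (b.compile σ r) (c.compile σ r))
  | sum x a, σ, r =>
    -- Register `r` accumulates the sum, `r + 1` holds the summation index, `r + 2` counts the
    -- remaining rounds down from the input length, and `r + 3` receives the summand and then the
    -- constant 1.
    .seq (.const r 0) <| .seq (.const (r + 1) 0) <| .seq (.add (r + 2) 0 r) <|
      .loop (r + 2) <| .seq (a.compile (Function.update σ x (r + 1)) (r + 3)) <|
        .seq (.add r r (r + 3)) <| .seq (.const (r + 3) 1) <|
        .seq (.add (r + 1) (r + 1) (r + 3)) (.sub (r + 2) (r + 2) (r + 3))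

open Polynomial in
/-- A bound for the running time of the compiled expression in terms of the input length. -/
noncomputable def Expr.cost : Expr → Polynomial ℕ
  | num _ => 1
  | size => 2
  | var _ => 2
  | add a b => a.cost + b.cost + 1
  | sub a b => a.cost + b.cost + 1
  | load a => a.cost + 1
  | cond a b c => a.cost + b.cost + c.cost + 1
  -- Each round adds four bookkeeping instructions and a test; outside the rounds there are three
  -- initialisations and the final test.
  | sum _ a => X * (a.cost + 5) + 4

/-- Leaving the registers below `r` untouched is what makes the induction work: it preserves the
input length in register 0, the variables, and values already computed for an enclosing expression.
-/
theorem Expr.compile_spec (e : Expr) : ∀ (σ : ℕ → ℕ) (r : ℕ) (s : State), 0 < r →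
    (∀ x, σ x < r) → ∃ s' t, Exec (e.compile σ r) s s' t ∧ t ≤ e.cost.eval (s.reg 0) ∧
      s'.mem = s.mem ∧ (∀ q < r, s'.reg q = s.reg q) ∧
      s'.reg r = e.eval (s.reg 0) (fun x => s.reg (σ x)) s.mem := by
  induction e with
  | num c =>
    intro σ r s hr hσ
    refine ⟨_, _, .const s r c, by simp [cost], rfl, fun q hq => ?_, ?_⟩
    · simp [State.setReg, hq.ne]
    · simp [State.setReg, eval]
  | size =>
    intro σ r s hr hσ
    refine ⟨_, _, .seq (.const s r 0) (.add _ r 0 r), by simp [cost], rfl, fun q hq => ?_, ?_⟩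
    · simp [State.setReg, hq.ne]
    · simp [State.setReg, eval, hr.ne]
  | var x =>
    intro σ r s hr hσ
    refine ⟨_, _, .seq (.const s r 0) (.add _ r (σ x) r), by simp [cost], rfl, fun q hq => ?_, ?_⟩
    · simp [State.setReg, hq.ne]
    · simp [State.setReg, eval, (hσ x).ne]
  | add a b iha ihb =>
    intro σ r s hr hσ
    obtain ⟨s₁, t₁, h₁, ht₁, hm₁, hf₁, hv₁⟩ := iha σ r s hr hσ
    obtain ⟨s₂, t₂, h₂, ht₂, hm₂, hf₂, hv₂⟩ :=
      ihb σ (r + 1) s₁ (by omega) (fun x => (hσ x).trans (by omega))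
    rw [hf₁ 0 hr] at ht₂ hv₂
    simp only [hf₁ _ (hσ _), hm₁] at hv₂
    refine ⟨_, _, .seq h₁ (.seq h₂ (.add _ _ _ _)), ?_, by simp [State.setReg, hm₁, hm₂],
      fun q hq => ?_, ?_⟩
    · simp only [cost, Polynomial.eval_add, Polynomial.eval_one]; omega
    · simp [State.setReg, hq.ne, hf₁ q hq, hf₂ q (by omega)]
    · simp [State.setReg, eval, hv₁, hv₂, hf₂ r (by omega)]
  | sub a b iha ihb =>
    intro σ r s hr hσ
    obtain ⟨s₁, t₁, h₁, ht₁, hm₁, hf₁, hv₁⟩ := iha σ r s hr hσ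
    obtain ⟨s₂, t₂, h₂, ht₂, hm₂, hf₂, hv₂⟩ :=
      ihb σ (r + 1) s₁ (by omega) (fun x => (hσ x).trans (by omega))
    rw [hf₁ 0 hr] at ht₂ hv₂
    simp only [hf₁ _ (hσ _), hm₁] at hv₂
    refine ⟨_, _, .seq h₁ (.seq h₂ (.sub _ _ _ _)), ?_, by simp [State.setReg, hm₁, hm₂],
      fun q hq => ?_, ?_⟩
    · simp only [cost, Polynomial.eval_add, Polynomial.eval_one]; omega
    · simp [State.setReg, hq.ne, hf₁ q hq, hf₂ q (by omega)]
    · simp [State.setReg, eval, hv₁, hv₂, hf₂ r (by omega)]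
  | load a iha =>
    intro σ r s hr hσ
    obtain ⟨s₁, t₁, h₁, ht₁, hm₁, hf₁, hv₁⟩ := iha σ r s hr hσ
    refine ⟨_, _, .seq h₁ (.load _ _ _), ?_, by simp [State.setReg, hm₁], fun q hq => ?_, ?_⟩
    · simp only [cost, Polynomial.eval_add, Polynomial.eval_one]; omega
    · simp [State.setReg, hq.ne, hf₁ q hq]
    · simp [State.setReg, eval, hv₁, hm₁]
  | cond a b c iha ihb ihc =>
    intro σ r s hr hσ
    obtain ⟨s₁, t₁, h₁, ht₁, hm₁, hf₁, hv₁⟩ := iha σ r s hr hσ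
    obtain ⟨s₂, t₂, h₂, ht₂, hm₂, hf₂, hv₂⟩ := ihb σ r s₁ hr hσ
    obtain ⟨s₃, t₃, h₃, ht₃, hm₃, hf₃, hv₃⟩ := ihc σ r s₁ hr hσ
    rw [hf₁ 0 hr] at ht₂ hv₂ ht₃ hv₃
    simp only [hf₁ _ (hσ _), hm₁] at hv₂ hv₃
    by_cases h0 : s₁.reg r = 0
    · refine ⟨s₃, _, .seq h₁ (.iteFalse h0 h₃), ?_, hm₃.trans hm₁,
        fun q hq => (hf₃ q hq).trans (hf₁ q hq), ?_⟩
      · simp only [cost, Polynomial.eval_add, Polynomial.eval_one]; omega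
      · rw [hv₁] at h0; simp [eval, h0, hv₃]
    · refine ⟨s₂, _, .seq h₁ (.iteTrue h0 h₂), ?_, hm₂.trans hm₁,
        fun q hq => (hf₂ q hq).trans (hf₁ q hq), ?_⟩
      · simp only [cost, Polynomial.eval_add, Polynomial.eval_one]; omega
      · rw [hv₁] at h0; simp [eval, h0, hv₂]
  | sum x a iha =>
    intro σ r s hr hσ
    set ρ : ℕ → ℕ := fun x => s.reg (σ x) with hρ
    set N := s.reg 0 with hN
    set body : Prog := .seq (a.compile (Function.update σ x (r + 1)) (r + 3)) <|
        .seq (.add r r (r + 3)) <| .seq (.const (r + 3) 1) <|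
        .seq (.add (r + 1) (r + 1) (r + 3)) (.sub (r + 2) (r + 2) (r + 3)) with hbody
    -- Loop invariant, by induction on the number `k` of remaining rounds: after `i` rounds the
    -- accumulator holds the first `i` summands.
    have key : ∀ k i : ℕ, i + k = N → ∀ s₁ : State, s₁.mem = s.mem →
        (∀ q < r, s₁.reg q = s.reg q) →
        s₁.reg r = ∑ j ∈ Finset.range i, a.eval N (Function.update ρ x j) s.mem →
        s₁.reg (r + 1) = i → s₁.reg (r + 2) = k →
        ∃ s' t, Exec (.loop (r + 2) body) s₁ s' t ∧ t ≤ k * (a.cost.eval N + 5) + 1 ∧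
          s'.mem = s.mem ∧ (∀ q < r, s'.reg q = s.reg q) ∧
          s'.reg r = ∑ j ∈ Finset.range N, a.eval N (Function.update ρ x j) s.mem := by
      intro k
      induction k with
      | zero =>
        intro i hi s₁ hm hf hv _ h2
        obtain rfl : i = N := hi
        exact ⟨s₁, _, .loopDone h2, by omega, hm, hf, hv⟩
      | succ k ih =>
        intro i hi s₁ hm hf hv h1 h2
        obtain ⟨s₂, t₂, h₂, ht₂, hm₂, hf₂, hv₂⟩ :=
          iha (Function.update σ x (r + 1)) (r + 3) s₁ (by omega) (fun y => by
            rcases eq_or_ne y x with rfl | hy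
            · simp
            · have := hσ y
              simp only [Function.update_of_ne hy]
              omega)
        rw [hf 0 hr, ← hN] at ht₂ hv₂
        have henv : (fun y => s₁.reg (Function.update σ x (r + 1) y)) = Function.update ρ x i := by
          funext y
          rcases eq_or_ne y x with rfl | hy
          · simp [h1]
          · simp [hy, hf _ (hσ y), hρ]
        rw [henv, hm] at hv₂
        have hb : ∃ s₃, Exec body s₁ s₃ (t₂ + (1 + (1 + (1 + 1)))) ∧ s₃.mem = s.mem ∧
            (∀ q < r, s₃.reg q = s.reg q) ∧
            s₃.reg r = ∑ j ∈ Finset.range (i + 1), a.eval N (Function.update ρ x j) s.mem ∧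
            s₃.reg (r + 1) = i + 1 ∧ s₃.reg (r + 2) = k := by
          refine ⟨_, .seq h₂ (.seq (.add _ _ _ _) (.seq (.const _ _ _) (.seq (.add _ _ _ _)
            (.sub _ _ _ _)))), hm₂.trans hm, fun q hq => ?_, ?_, ?_, ?_⟩
          · have e0 : q ≠ r := by omega
            have e1 : q ≠ r + 1 := by omega
            have e2 : q ≠ r + 2 := by omega
            have e3 : q ≠ r + 3 := by omega
            simp [State.setReg, e0, e1, e2, e3, hf₂ q (by omega), hf q hq]
          · simp [State.setReg, hf₂ r (by omega), hv, hv₂, Finset.sum_range_succ, hN]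
          · simp [State.setReg, hf₂ (r + 1) (by omega), h1]
          · simp [State.setReg, hf₂ (r + 2) (by omega), h2]
        obtain ⟨s₃, h₃, hm₃, hf₃, hv₃, h31, h32⟩ := hb
        obtain ⟨s₄, t₄, h₄, ht₄, hm₄, hf₄, hv₄⟩ := ih (i + 1) (by omega) s₃ hm₃ hf₃ hv₃ h31 h32
        refine ⟨s₄, _, .loopStep (by omega) h₃ h₄, ?_, hm₄, hf₄, hv₄⟩
        have : (k + 1) * (a.cost.eval N + 5) = k * (a.cost.eval N + 5) + (a.cost.eval N + 5) := by
          ring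
        omega
    obtain ⟨s', t, h, ht, hm, hf, hv⟩ := key N 0 (by omega)
      (((s.setReg r 0).setReg (r + 1) 0).setReg (r + 2) (N + 0)) rfl
      (fun q hq => by
        have e0 : q ≠ r := by omega
        have e1 : q ≠ r + 1 := by omega
        have e2 : q ≠ r + 2 := by omega
        simp [State.setReg, e0, e1, e2])
      (by simp [State.setReg]) (by simp [State.setReg]) (by simp [State.setReg])
    refine ⟨s', _, .seq (.const _ _ _) (.seq (.const _ _ _) (.seq (.add _ _ _ _) (?_ :
      Exec _ _ _ t))), ?_, hm, hf, hv⟩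
    · convert h using 2
      simp [State.setReg, hr.ne, hN]
    · simp only [cost, Polynomial.eval_add, Polynomial.eval_mul, Polynomial.eval_X,
        Polynomial.eval_ofNat]
      omega

/-- Statements that modify the memory. Loops range over the numbers below the input length. -/
inductive Stmt : Type
  | store (a b : Expr) : Stmt
  | times (x : ℕ) (c : Stmt) : Stmt

/-- The memory after `k` iterations of `f`, started in `m`. -/
def iterate (f : ℕ → (ℕ → ℕ) → ℕ → ℕ) (m : ℕ → ℕ) : ℕ → ℕ → ℕ
  | 0 => m
  | k + 1 => f k (iterate f m k)

/-- The memory after the execution of a statement, for input length `N`, environment `ρ` and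
memory `m`. -/
def Stmt.run (N : ℕ) : Stmt → (ℕ → ℕ) → (ℕ → ℕ) → ℕ → ℕ
  | store a b, ρ, m => Function.update m (a.eval N ρ m) (b.eval N ρ m)
  | .times x c, ρ, m => iterate (fun i m => c.run N (Function.update ρ x i) m) m N

/-- `c.compile σ r` executes `c`, where the variable `x` is held in register `σ x`, and registers
from `r` on are free. -/
def Stmt.compile : Stmt → (ℕ → ℕ) → ℕ → Prog
  | store a b, σ, r => .seq (a.compile σ r) (.seq (b.compile σ (r + 1)) (.store r (r + 1)))
  | .times x c, σ, r =>
    .seq (.const r 0) <| .seq (.add (r + 1) 0 r) <|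
      .loop (r + 1) <| .seq (c.compile (Function.update σ x r) (r + 2)) <|
        .seq (.const (r + 2) 1) <|
        .seq (.add r r (r + 2)) (.sub (r + 1) (r + 1) (r + 2))

open Polynomial in
/-- A bound for the running time of the compiled statement in terms of the input length. -/
noncomputable def Stmt.cost : Stmt → Polynomial ℕ
  | store a b => a.cost + b.cost + 1
  -- Three bookkeeping instructions and a test per round; two initialisations and the final test
  -- outside.
  | .times _ c => X * (c.cost + 4) + 3

theorem Stmt.compile_spec (c : Stmt) : ∀ (σ : ℕ → ℕ) (r : ℕ) (s : State), 0 < r →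
    (∀ x, σ x < r) → ∃ s' t, Exec (c.compile σ r) s s' t ∧ t ≤ c.cost.eval (s.reg 0) ∧
      (∀ q < r, s'.reg q = s.reg q) ∧
      s'.mem = c.run (s.reg 0) (fun x => s.reg (σ x)) s.mem := by
  induction c with
  | store a b =>
    intro σ r s hr hσ
    obtain ⟨s₁, t₁, h₁, ht₁, hm₁, hf₁, hv₁⟩ := a.compile_spec σ r s hr hσ
    obtain ⟨s₂, t₂, h₂, ht₂, hm₂, hf₂, hv₂⟩ :=
      b.compile_spec σ (r + 1) s₁ (by omega) (fun x => (hσ x).trans (by omega))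
    rw [hf₁ 0 hr] at ht₂ hv₂
    simp only [hf₁ _ (hσ _), hm₁] at hv₂
    refine ⟨_, _, .seq h₁ (.seq h₂ (.store _ _ _)), ?_, fun q hq => ?_, ?_⟩
    · simp only [cost, Polynomial.eval_add, Polynomial.eval_one]; omega
    · simp [State.setMem, hf₁ q hq, hf₂ q (by omega)]
    · simp [State.setMem, run, hm₁, hm₂, hv₁, hv₂, hf₂ r (by omega)]
  | times x c ihc =>
    intro σ r s hr hσ
    set ρ : ℕ → ℕ := fun x => s.reg (σ x) with hρ
    set N := s.reg 0 with hN
    set body : Prog := .seq (c.compile (Function.update σ x r) (r + 2)) <|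
        .seq (.const (r + 2) 1) <|
        .seq (.add r r (r + 2)) (.sub (r + 1) (r + 1) (r + 2)) with hbody
    set f : ℕ → (ℕ → ℕ) → ℕ → ℕ := fun i m => c.run N (Function.update ρ x i) m with hfdef
    have key : ∀ k i : ℕ, i + k = N → ∀ s₁ : State, s₁.mem = iterate f s.mem i →
        (∀ q < r, s₁.reg q = s.reg q) → s₁.reg r = i → s₁.reg (r + 1) = k →
        ∃ s' t, Exec (.loop (r + 1) body) s₁ s' t ∧ t ≤ k * (c.cost.eval N + 4) + 1 ∧
          (∀ q < r, s'.reg q = s.reg q) ∧ s'.mem = iterate f s.mem N := by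
      intro k
      induction k with
      | zero =>
        intro i hi s₁ hm hf _ h2
        obtain rfl : i = N := hi
        exact ⟨s₁, _, .loopDone h2, by omega, hf, hm⟩
      | succ k ih =>
        intro i hi s₁ hm hf h1 h2
        obtain ⟨s₂, t₂, h₂, ht₂, hf₂, hm₂⟩ :=
          ihc (Function.update σ x r) (r + 2) s₁ (by omega) (fun y => by
            rcases eq_or_ne y x with rfl | hy
            · simp
            · have := hσ y
              simp only [Function.update_of_ne hy]
              omega)
        rw [hf 0 hr, ← hN] at ht₂ hm₂
        have henv : (fun y => s₁.reg (Function.update σ x r y)) = Function.update ρ x i := by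
          funext y
          rcases eq_or_ne y x with rfl | hy
          · simp [h1]
          · simp [hy, hf _ (hσ y), hρ]
        rw [henv, hm] at hm₂
        have hb : ∃ s₃, Exec body s₁ s₃ (t₂ + (1 + (1 + 1))) ∧ s₃.mem = iterate f s.mem (i + 1) ∧
            (∀ q < r, s₃.reg q = s.reg q) ∧ s₃.reg r = i + 1 ∧ s₃.reg (r + 1) = k := by
          refine ⟨_, .seq h₂ (.seq (.const _ _ _) (.seq (.add _ _ _ _) (.sub _ _ _ _))), hm₂,
            fun q hq => ?_, ?_, ?_⟩
          · have e0 : q ≠ r := by omega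
            have e1 : q ≠ r + 1 := by omega
            have e2 : q ≠ r + 2 := by omega
            simp [State.setReg, e0, e1, e2, hf₂ q (by omega), hf q hq]
          · simp [State.setReg, hf₂ r (by omega), h1]
          · simp [State.setReg, hf₂ (r + 1) (by omega), h2]
        obtain ⟨s₃, h₃, hm₃, hf₃, h31, h32⟩ := hb
        obtain ⟨s₄, t₄, h₄, ht₄, hf₄, hm₄⟩ := ih (i + 1) (by omega) s₃ hm₃ hf₃ h31 h32
        refine ⟨s₄, _, .loopStep (by omega) h₃ h₄, ?_, hf₄, hm₄⟩
        have : (k + 1) * (c.cost.eval N + 4) = k * (c.cost.eval N + 4) + (c.cost.eval N + 4) := by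
          ring
        omega
    obtain ⟨s', t, h, ht, hf, hm⟩ := key N 0 (by omega)
      ((s.setReg r 0).setReg (r + 1) (N + 0)) rfl
      (fun q hq => by
        have e0 : q ≠ r := by omega
        have e1 : q ≠ r + 1 := by omega
        simp [State.setReg, e0, e1])
      (by simp [State.setReg]) (by simp [State.setReg])
    refine ⟨s', _, .seq (.const _ _ _) (.seq (.add _ _ _ _) (?_ : Exec _ _ _ t)), ?_, hf, hm⟩
    · convert h using 2
      simp [State.setReg, hr.ne, hN]
    · simp only [cost, Polynomial.eval_add, Polynomial.eval_mul, Polynomial.eval_X,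
        Polynomial.eval_ofNat]
      omega

/-- A problem is solvable in polynomial time if some statement and some expression decide it. -/
theorem solvableInPolyTime_of_stmt {α : Type*} {enc : α → List Bool} {dom yes : α → Prop}
    (c : Stmt) (e : Expr)
    (h : ∀ x, dom x → (e.eval (enc x).length (fun _ => (enc x).length)
      (c.run (enc x).length (fun _ => (enc x).length) (input (enc x)).mem) ≠ 0 ↔ yes x)) :
    SolvableInPolyTime enc dom yes := by
  -- All variables initially live in register 0, which is why the environment is constantly the
  -- input length. The last two instructions move the answer from register 1 to register 0.
  refine ⟨.seq (c.compile (fun _ => 0) 1) (.seq (e.compile (fun _ => 0) 1)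
    (.seq (.const 0 0) (.add 0 0 1))), c.cost + e.cost + 2, fun x hx => ?_⟩
  obtain ⟨s₁, t₁, h₁, ht₁, hf₁, hm₁⟩ :=
    c.compile_spec (fun _ => 0) 1 (input (enc x)) one_pos (fun _ => one_pos)
  obtain ⟨s₂, t₂, h₂, ht₂, -, -, hv₂⟩ := e.compile_spec (fun _ => 0) 1 s₁ one_pos (fun _ => one_pos)
  have h0 : (input (enc x)).reg 0 = (enc x).length := rfl
  simp only [hf₁ 0 one_pos, h0, hm₁] at ht₁ ht₂ hv₂
  refine ⟨_, _, .seq h₁ (.seq h₂ (.seq (.const _ _ _) (.add _ _ _ _))), ?_, ?_⟩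
  · simp only [Polynomial.eval_add, Polynomial.eval_ofNat]; omega
  · rw [← h x hx, ← hv₂]; simp [State.setReg]

end RAM

/-! ### Shortest walks -/

namespace SimpleGraph

variable {V : Type*} {G : SimpleGraph V}

/-- Both parts of a shortest walk are shortest walks. -/
theorem Walk.length_eq_dist_of_append {u v w : V} {p : G.Walk u v} {q : G.Walk v w}
    (h : (p.append q).length = G.dist u w) : p.length = G.dist u v ∧ q.length = G.dist v w := by
  have h₁ := dist_le p
  have h₂ := dist_le q
  have h₃ := p.reachable.dist_triangle_left w
  rw [Walk.length_append] at h
  omega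

theorem Walk.dist_add_dist_of_mem_support {u v w : V} {p : G.Walk u v}
    (h : p.length = G.dist u v) (hw : w ∈ p.support) :
    G.dist u w + G.dist w v = G.dist u v := by
  classical
  rw [← p.take_spec hw] at h
  obtain ⟨h₁, h₂⟩ := Walk.length_eq_dist_of_append h
  rw [← h₁, ← h₂, ← h, Walk.length_append]

theorem Connected.exists_walk_mem_support (hG : G.Connected) {u v w : V}
    (h : G.dist u w + G.dist w v = G.dist u v) :
    ∃ p : G.Walk u v, p.length = G.dist u v ∧ w ∈ p.support := by
  obtain ⟨p, hp⟩ := hG.exists_walk_length_eq_dist u w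
  obtain ⟨q, hq⟩ := hG.exists_walk_length_eq_dist w v
  exact ⟨p.append q, by rw [Walk.length_append, hp, hq, h], by simp⟩

/-- A walk from `u` to a vertex of `s` can be cut off at its first vertex in `s`. -/
theorem Walk.exists_first_mem {u v : V} (p : G.Walk u v) (s : Set V) (hv : v ∈ s) :
    ∃ (b : V) (q : G.Walk u b) (r : G.Walk b v), p = q.append r ∧ b ∈ s ∧
      ∀ y ∈ q.support, y ∈ s → y = b := by
  induction p with
  | nil => exact ⟨_, .nil, .nil, rfl, hv, by simp⟩
  | @cons u x v h p ih =>
    by_cases hu : u ∈ s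
    · exact ⟨u, .nil, .cons h p, rfl, hu, by simp⟩
    · obtain ⟨b, q, r, rfl, hb, hq⟩ := ih hv
      refine ⟨b, .cons h q, r, rfl, hb, fun y hy hys => ?_⟩
      rw [Walk.support_cons, List.mem_cons] at hy
      rcases hy with rfl | hy
      · exact absurd hys hu
      · exact hq y hy hys

/-- If a shortest walk `q` visits a vertex `w` off the shortest walk `p` with the same ends, then
some part of `p` can be replaced by a detour through `w` that is disjoint from `p`. -/
theorem Connected.exists_detour (hG : G.Connected) {u v w : V} {p q : G.Walk u v}
    (hp : p.length = G.dist u v) (hq : q.length = G.dist u v) (hwq : w ∈ q.support)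
    (hwp : w ∉ p.support) :
    ∃ (a b : V) (p₁ : G.Walk u a) (p₂ q₂ : G.Walk a b) (p₃ : G.Walk b v),
      p = p₁.append (p₂.append p₃) ∧ w ∈ q₂.support ∧ p₂.IsPath ∧ q₂.IsPath ∧
      (p₁.append (q₂.append p₃)).length = G.dist u v ∧
      ∀ y ∈ p₂.support, y ∈ q₂.support → y = a ∨ y = b := by
  classical
  -- From `w`, follow `q` forwards and backwards until it first meets `p`, at `b` and `a`; the piece
  -- of `q` in between is the detour.
  obtain ⟨b, r₂, r₃, hr, hbp, hb⟩ :=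
    (q.dropUntil w hwq).exists_first_mem {y | y ∈ p.support} (by simp)
  obtain ⟨a, l₂, l₁, hl, hap, ha⟩ :=
    (q.takeUntil w hwq).reverse.exists_first_mem {y | y ∈ p.support} (by simp)
  have hq' : q = l₁.reverse.append ((l₂.reverse.append r₂).append r₃) := by
    have := congrArg Walk.reverse hl
    rw [Walk.reverse_reverse, Walk.reverse_append] at this
    rw [← q.take_spec hwq, hr, this]
    simp [Walk.append_assoc]
  set q₂ := l₂.reverse.append r₂ with hq₂
  rw [hq'] at hq
  obtain ⟨-, hq₂₃⟩ := Walk.length_eq_dist_of_append hq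
  obtain ⟨hq₂l, -⟩ := Walk.length_eq_dist_of_append hq₂₃
  have hab : G.dist u a + G.dist a b = G.dist u b := by
    rw [Walk.append_assoc] at hq
    obtain ⟨h, -⟩ := Walk.length_eq_dist_of_append hq
    exact Walk.dist_add_dist_of_mem_support h (by simp [Walk.mem_support_append_iff])
  have hwa : w ≠ a := by rintro rfl; exact hwp hap
  have hwb : w ≠ b := by rintro rfl; exact hwp hbp
  have hne : a ≠ b := by
    rintro rfl
    rw [dist_self] at hq₂l
    have : w ∈ q₂.support := by simp [hq₂]
    rw [(Walk.length_eq_zero_iff.mp hq₂l).eq_nil, Walk.support_nil, List.mem_singleton] at this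
    exact hwa this
  have hpos := hG.pos_dist_of_ne hne
  -- Along the geodesic `q`, `a` comes before `b`, so it is nearer to `u`; hence the same order
  -- holds on `p`.
  have hbd : b ∈ (p.dropUntil a hap).support := by
    have hb' : b ∈ p.support := hbp
    rw [← p.take_spec hap, Walk.mem_support_append_iff] at hb'
    refine hb'.resolve_left fun h => ?_
    rw [← p.take_spec hap] at hp
    have := Walk.dist_add_dist_of_mem_support (Walk.length_eq_dist_of_append hp).1 h
    omega
  have hpe : p = (p.takeUntil a hap).append
      (((p.dropUntil a hap).takeUntil b hbd).append ((p.dropUntil a hap).dropUntil b hbd)) := by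
    rw [Walk.take_spec, Walk.take_spec]
  have hp' := hp
  rw [hpe] at hp'
  have hp₂ := (Walk.length_eq_dist_of_append (Walk.length_eq_dist_of_append hp').2).1
  refine ⟨a, b, _, _, q₂, _, hpe, by simp [hq₂], Walk.isPath_of_length_eq_dist _ hp₂,
    Walk.isPath_of_length_eq_dist _ hq₂l, ?_, fun y hy hyq => ?_⟩
  · rw [← hp']
    simp only [Walk.length_append]
    omega
  · have hyp : y ∈ p.support :=
      p.support_dropUntil_subset_support hap
        (Walk.support_takeUntil_subset_support _ hbd hy)
    rw [hq₂, Walk.mem_support_append_iff, Walk.support_reverse, List.mem_reverse] at hyq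
    rcases hyq with h | h
    · exact Or.inl (ha y h hyp)
    · exact Or.inr (hb y h hyp)

end SimpleGraph

/-! ### Strong geodetic sets of cacti -/

section Cactus

open SimpleGraph

variable {V : Type*} {G : SimpleGraph V}

/-- Two vertices on the two arcs of a cycle in a cactus between `a` and `b` separate `a` from
`b`. -/
theorem IsCactus.mem_support_or_mem_support (hG : IsCactus G) {a b x w : V} {p q : G.Walk a b}
    (hp : p.IsPath) (hq : q.IsPath) (hpq : ∀ y ∈ p.support, y ∈ q.support → y = a ∨ y = b)
    (hx : x ∈ p.support) (hxa : x ≠ a) (hxb : x ≠ b)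
    (hw : w ∈ q.support) (hwa : w ≠ a) (hwb : w ≠ b) (r : G.Walk a b) :
    x ∈ r.support ∨ w ∈ r.support := by
  classical
  by_contra! hr
  obtain ⟨hxr, hwr⟩ := hr
  have hwp : w ∉ p.support := fun h => by
    rcases hpq w h hw with h | h
    · exact hwa h
    · exact hwb h
  obtain ⟨p₁, p₂, rfl⟩ : ∃ (p₁ : G.Walk a x) (p₂ : G.Walk x b), p = p₁.append p₂ :=
    ⟨_, _, (p.take_spec hx).symm⟩
  obtain ⟨x', hadj, p₃, rfl⟩ : ∃ (x' : V) (h : G.Adj x x') (p₃ : G.Walk x' b),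
      p₂ = .cons h p₃ := by
    cases p₂ with
    | nil => exact absurd rfl hxb
    | cons h p₃ => exact ⟨_, h, p₃, rfl⟩
  -- The first cycle consists of both arcs. The second one, `hC'` below, shares with it the edge
  -- from `x` to its successor `x'` on `p`, but avoids `w`.
  have hC : ((p₁.append (.cons hadj p₃)).append q.reverse).IsCycle := by
    refine hp.isCycle_append hq.reverse (fun y hy hyq => ?_) (Or.inl ?_)
    · have h₁ := hp.support_nodup
      rw [← Walk.cons_tail_support] at h₁
      have h₂ := hq.reverse.support_nodup
      rw [← Walk.cons_tail_support] at h₂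
      have h₃ : y ∈ q.support := by
        simpa using List.mem_of_mem_tail hyq
      rcases hpq y (List.mem_of_mem_tail hy) h₃ with rfl | rfl
      · exact (List.nodup_cons.mp h₁).1 hy
      · exact (List.nodup_cons.mp h₂).1 hyq
    · have : p₁.length ≠ 0 := fun h => hxa (Walk.eq_of_length_eq_zero h).symm
      simp only [Walk.length_append, Walk.length_cons]
      omega
  have hxp₃ : x ∉ p₃.support := ((Walk.cons_isPath_iff _ _).mp hp.of_append_right).2
  have hep₁ : s(x, x') ∉ p₁.edges := fun h => by
    have := (Walk.isTrail_append _ _).mp hp.isTrail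
    exact this.2.2 h (by simp)
  -- Back along `p` from `x` to `a`, over `r` to `b`, and back along `p` to `x'`: this joins the
  -- ends of the edge without using it, since `r` avoids `x`.
  set T : G.Walk x x' := p₁.reverse.append (r.append p₃.reverse) with hT
  have heT : s(x, x') ∉ T.edges := by
    simp only [hT, Walk.edges_append, Walk.edges_reverse, List.mem_append, List.mem_reverse, not_or]
    exact ⟨hep₁, fun h => hxr (r.fst_mem_support_of_mem_edges h),
      fun h => hxp₃ (p₃.fst_mem_support_of_mem_edges h)⟩
  simp only [Walk.mem_support_append_iff, Walk.support_cons, List.mem_cons, not_or] at hwp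
  have hwT : w ∉ T.support := by
    simp only [hT, Walk.mem_support_append_iff, Walk.support_reverse, List.mem_reverse, not_or]
    exact ⟨hwp.1, hwr, hwp.2.2⟩
  have hC' : (Walk.cons hadj.symm T.bypass).IsCycle := by
    rw [Walk.cons_isCycle_iff]
    refine ⟨T.bypass_isPath, fun h => heT ?_⟩
    rw [Sym2.eq_swap]
    exact T.edges_bypass_subset_edges h
  obtain ⟨f, hf, hwf⟩ : ∃ f ∈ q.edges, w ∈ f := by
    have hnil : ¬ q.Nil := fun h => by
      rw [Walk.nil_iff_support_eq.mp h] at hw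
      exact hwa (by simpa using hw)
    exact (Walk.mem_support_iff_exists_mem_edges_of_not_nil hnil).mp hw
  -- The cycles share an edge, so they have the same edges; the second one would then visit `w`.
  have := (hG.2 _ _ _ _ hC hC' s(x, x') (by simp) (by simp [Sym2.eq_swap]) f).mp (by simp [hf])
  have hwC : w ∈ (Walk.cons hadj.symm T.bypass).support :=
    Walk.mem_support_of_mem_edges this hwf
  rw [Walk.support_cons, List.mem_cons] at hwC
  rcases hwC with h | h
  · exact hwp.2.2 (h ▸ p₃.start_mem_support)
  · exact hwT (T.support_bypass_subset_support h)

/-- A choice of one shortest walk for every unordered pair of elements of `S`. -/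
def IsGeodesicChoice (G : SimpleGraph V) (S : Finset V)
    (P : ∀ u v : S, G.Walk (u : V) (v : V)) : Prop :=
  (∀ u v : S, (P u v).length = G.dist (u : V) (v : V)) ∧
    ∀ u v : S, P v u = (P u v).reverse

theorem IsGeodesicChoice.exists_update {S : Finset V} {P : ∀ u v : S, G.Walk (u : V) (v : V)}
    (hP : IsGeodesicChoice G S P) {u v : S} (huv : u ≠ v) (r : G.Walk (u : V) (v : V))
    (hr : r.length = G.dist (u : V) (v : V)) :
    ∃ P', IsGeodesicChoice G S P' ∧ P' u v = r ∧
      ∀ a b : S, ¬(a = u ∧ b = v) → ¬(a = v ∧ b = u) → P' a b = P a b := by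
  classical
  let P' : ∀ a b : S, G.Walk (a : V) (b : V) := fun a b =>
    if h : a = u ∧ b = v then r.copy (by rw [h.1]) (by rw [h.2])
    else if h : a = v ∧ b = u then r.reverse.copy (by rw [h.1]) (by rw [h.2])
    else P a b
  have h₁ : P' u v = r := by simp [P']
  have h₂ : P' v u = r.reverse := by simp [P', huv, huv.symm]
  have h₃ : ∀ a b : S, ¬(a = u ∧ b = v) → ¬(a = v ∧ b = u) → P' a b = P a b := fun a b h h' => by
    simp only [P', dif_neg h, dif_neg h']
  refine ⟨P', ⟨fun a b => ?_, fun a b => ?_⟩, h₁, h₃⟩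
  · by_cases h : a = u ∧ b = v
    · obtain ⟨rfl, rfl⟩ := h
      rw [h₁, hr]
    by_cases h' : a = v ∧ b = u
    · obtain ⟨rfl, rfl⟩ := h'
      rw [h₂, Walk.length_reverse, hr, dist_comm]
    rw [h₃ a b h h', hP.1]
  · by_cases h : a = u ∧ b = v
    · obtain ⟨rfl, rfl⟩ := h
      rw [h₁, h₂]
    by_cases h' : a = v ∧ b = u
    · obtain ⟨rfl, rfl⟩ := h'
      rw [h₁, h₂, Walk.reverse_reverse]
    rw [h₃ a b h h', h₃ b a (by tauto) (by tauto), hP.2]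

/-- The linear order serves only to orient each unordered pair, so that opposite pairs get reversed
walks. -/
theorem SimpleGraph.Connected.exists_isGeodesicChoice [LinearOrder V] (hG : G.Connected)
    (S : Finset V) : ∃ P, IsGeodesicChoice G S P := by
  choose g hg using fun u v : V => hG.exists_walk_length_eq_dist u v
  refine ⟨fun u v => if (u : V) < v then g u v else (g v u).reverse, fun u v => ?_, fun u v => ?_⟩
  · dsimp only
    split_ifs
    · exact hg _ _
    · rw [Walk.length_reverse, hg, dist_comm]
  · rcases lt_trichotomy (u : V) v with h | h | h
    · simp [h, h.not_gt]
    · obtain rfl : u = v := Subtype.ext h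
      have h0 : (g u u).length = 0 := by rw [hg, dist_self]
      dsimp only
      rw [if_neg (lt_irrefl _), (Walk.length_eq_zero_iff.mp h0).eq_nil]
      rfl
    · simp [h, h.not_gt]

/-- In a cactus, a geodetic set with at least three elements is strong geodetic. -/
theorem IsCactus.isStrongGeodetic_of_geodetic [Fintype V] [LinearOrder V] (hG : IsCactus G)
    {S : Finset V} (hS : 3 ≤ S.card)
    (h : ∀ w ∉ S, ∃ u ∈ S, ∃ v ∈ S, G.dist u w + G.dist w v = G.dist u v) :
    IsStrongGeodetic G S := by
  classical
  -- `U P` is the set of uncovered vertices; `P` is then taken to minimise its size.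
  let U : (∀ u v : S, G.Walk (u : V) (v : V)) → Finset V := fun P =>
    Finset.univ.filter fun w => w ∉ S ∧ ∀ u v : S, w ∉ (P u v).support
  have hU : ∀ P w, w ∈ U P ↔ w ∉ S ∧ ∀ u v : S, w ∉ (P u v).support := by simp [U]
  have hex : ∃ k P, IsGeodesicChoice G S P ∧ (U P).card = k :=
    let ⟨P, hP⟩ := hG.1.exists_isGeodesicChoice S
    ⟨_, P, hP, rfl⟩
  obtain ⟨P, hP, hcard⟩ := Nat.find_spec hex
  have hmin : ∀ P', IsGeodesicChoice G S P' → (U P).card ≤ (U P').card := fun P' hP' =>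
    hcard ▸ Nat.find_min' hex ⟨P', hP', rfl⟩
  refine ⟨P, hP.1, hP.2, ?_⟩
  by_contra! hcon
  obtain ⟨w, hwS, hw⟩ := hcon
  obtain ⟨u, hu, v, hv, huwv⟩ := h w hwS
  lift u to S using hu
  lift v to S using hv
  obtain ⟨q, hq, hwq⟩ := hG.1.exists_walk_mem_support huwv
  have huv : u ≠ v := by
    rintro rfl
    rw [dist_self] at hq
    rw [(Walk.length_eq_zero_iff.mp hq).eq_nil, Walk.support_nil, List.mem_singleton] at hwq
    exact hwS (hwq ▸ u.2)
  obtain ⟨a, b, p₁, p₂, q₂, p₃, hp, hwq₂, hp₂, hq₂, hlen, hdisj⟩ :=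
    hG.1.exists_detour (hP.1 u v) hq hwq (hw u v)
  obtain ⟨P', hP', hP'uv, hP'e⟩ := hP.exists_update huv _ hlen
  have hwU : w ∈ U P := (hU P w).mpr ⟨hwS, hw⟩
  have hwU' : w ∉ U P' := fun hw' => ((hU P' w).mp hw').2 u v (by
    simp [hP'uv, Walk.mem_support_append_iff, hwq₂])
  -- The new choice gains `w`, so by minimality it loses some `x`. Only the path of the pair `u`,
  -- `v` changed, so `x` lies on the discarded arc `p₂`.
  obtain ⟨x, hxU', hxU⟩ : ∃ x ∈ U P', x ∉ U P := by
    by_contra! hsub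
    exact (hmin P' hP').not_gt
      (Finset.card_lt_card ⟨hsub, fun hsup => hwU' (hsup hwU)⟩)
  rw [hU] at hxU' hxU
  obtain ⟨hxS, hx'⟩ := hxU'
  push Not at hxU
  obtain ⟨c, d, hxcd⟩ := hxU hxS
  have hxp : x ∈ (P u v).support := by
    by_cases h₁ : c = u ∧ d = v
    · rwa [h₁.1, h₁.2] at hxcd
    by_cases h₂ : c = v ∧ d = u
    · rw [h₂.1, h₂.2, hP.2 u v, Walk.support_reverse, List.mem_reverse] at hxcd
      exact hxcd
    · exact absurd (hP'e c d h₁ h₂ ▸ hxcd) (hx' c d)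
  have hxq := hx' u v
  rw [hP'uv] at hxq
  have hwp := hw u v
  rw [hp] at hxp hwp
  simp only [Walk.mem_support_append_iff, not_or] at hxp hxq hwp
  obtain ⟨z, hzu, hzv⟩ : ∃ z : S, z ≠ u ∧ z ≠ v := by
    have : ∃ z ∈ S, z ∉ ({(u : V), (v : V)} : Finset V) := by
      refine Finset.exists_mem_notMem_of_card_lt_card ?_
      have := Finset.card_le_two (a := (u : V)) (b := (v : V))
      omega
    obtain ⟨z, hz, hzn⟩ := this
    refine ⟨⟨z, hz⟩, fun h => hzn ?_, fun h => hzn ?_⟩ <;> simp [← h]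
  have hzu' := hP'e u z (by tauto) (by tauto)
  have hzv' := hP'e z v (by tauto) (by tauto)
  have hx₂ : x ∈ p₂.support := by tauto
  -- The test walk from `a` to `b` runs through `u`, `z` and `v`. The parts `p₁` and `p₃` belong to
  -- both the old and the new path, hence avoid `w` and `x`; the paths through `z` are unchanged, so
  -- they avoid both as well.
  have key := hG.mem_support_or_mem_support hp₂ hq₂ hdisj hx₂
    (fun h => hxq.1 (h ▸ p₁.end_mem_support)) (fun h => hxq.2.2 (h ▸ p₃.start_mem_support))
    hwq₂ (fun h => hwp.1 (h ▸ p₁.end_mem_support)) (fun h => hwp.2.2 (h ▸ p₃.start_mem_support))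
    (p₁.reverse.append (((P u z).append (P z v)).append p₃.reverse))
  simp only [Walk.mem_support_append_iff, Walk.support_reverse, List.mem_reverse] at key
  have k₁ := hx' u z
  have k₂ := hx' z v
  rw [hzu'] at k₁
  rw [hzv'] at k₂
  have k₃ := hw u z
  have k₄ := hw z v
  tauto

/-- A description of the strong geodetic sets of a cactus in terms of distances. -/
theorem IsCactus.isStrongGeodetic_iff [Fintype V] [LinearOrder V] (hG : IsCactus G)
    (S : Finset V) :
    IsStrongGeodetic G S ↔ (∃ u ∈ S, ∃ v ∈ S, G.dist u v + 1 = Fintype.card V) ∨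
      (3 ≤ S.card ∧ ∀ w ∉ S, ∃ u ∈ S, ∃ v ∈ S, G.dist u w + G.dist w v = G.dist u v) := by
  classical
  constructor
  · rintro ⟨P, hlen, hrev, hcov⟩
    by_cases hS : 3 ≤ S.card
    · refine Or.inr ⟨hS, fun w hw => ?_⟩
      obtain ⟨u, v, huv⟩ := hcov w hw
      exact ⟨u, u.2, v, v.2, Walk.dist_add_dist_of_mem_support (hlen u v) huv⟩
    · left
      -- With fewer than three elements, `S` consists of `u` and `v`, possibly equal, and a single
      -- path has to cover the whole graph.
      obtain ⟨u, v, huv⟩ : ∃ u v : S, ∀ z : S, z = u ∨ z = v := by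
        have hne : S.Nonempty := by
          obtain ⟨w⟩ := hG.1.nonempty
          by_cases hw : w ∈ S
          · exact ⟨w, hw⟩
          · obtain ⟨u, -⟩ := hcov w hw
            exact ⟨u, u.2⟩
        have hpos := hne.card_pos
        have : S.card = 1 ∨ S.card = 2 := by omega
        rcases this with h | h
        · obtain ⟨u, rfl⟩ := Finset.card_eq_one.mp h
          exact ⟨⟨u, by simp⟩, ⟨u, by simp⟩, fun z => Or.inl (Subtype.ext (Finset.mem_singleton.mp z.2))⟩
        · obtain ⟨u, v, -, rfl⟩ := Finset.card_eq_two.mp h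
          exact ⟨⟨u, by simp⟩, ⟨v, by simp⟩, fun z => by
            simpa only [Subtype.ext_iff, Finset.mem_insert, Finset.mem_singleton] using z.2⟩
      have hself : ∀ z : S, (P z z).support = [(z : V)] := fun z => by
        have h0 : (P z z).length = 0 := by rw [hlen, SimpleGraph.dist_self]
        rw [(Walk.length_eq_zero_iff.mp h0).eq_nil, Walk.support_nil]
      have hall : ∀ w : V, w ∈ (P u v).support := fun w => by
        by_cases hw : w ∈ S
        · rcases huv ⟨w, hw⟩ with h | h
          · rw [show w = u from congrArg Subtype.val h]; simp
          · rw [show w = v from congrArg Subtype.val h]; simp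
        · obtain ⟨c, d, hcd⟩ := hcov w hw
          have hne : c ≠ d := by
            rintro rfl
            rw [hself, List.mem_singleton] at hcd
            exact hw (hcd ▸ c.2)
          rcases huv c with rfl | rfl <;> rcases huv d with rfl | rfl
          · exact absurd rfl hne
          · exact hcd
          · rw [hrev] at hcd
            simpa using hcd
          · exact absurd rfl hne
      refine ⟨u, u.2, v, v.2, ?_⟩
      have hpath := Walk.isPath_of_length_eq_dist _ (hlen u v)
      rw [← hlen, ← Walk.length_support, ← List.toFinset_card_of_nodup hpath.support_nodup,
        ← Finset.card_univ]
      congr 1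
      ext w
      simp [hall w]
  · rintro (⟨u, hu, v, hv, huv⟩ | ⟨hS, h⟩)
    · lift u to S using hu
      lift v to S using hv
      obtain ⟨P, hP⟩ := hG.1.exists_isGeodesicChoice S
      rcases eq_or_ne u v with rfl | hne
      -- Here the graph has a single vertex, and nothing lies outside `S`.
      · rw [SimpleGraph.dist_self, zero_add] at huv
        have := Fintype.card_le_one_iff.mp huv.ge
        exact ⟨P, hP.1, hP.2, fun w hw => absurd (this w u ▸ u.2) hw⟩
      · obtain ⟨r, hr⟩ := hG.1.exists_walk_length_eq_dist (u : V) v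
        obtain ⟨P', hP', hr', -⟩ := hP.exists_update hne r hr
        refine ⟨P', hP'.1, hP'.2, fun w _ => ⟨u, v, ?_⟩⟩
        have hpath := Walk.isPath_of_length_eq_dist _ hr
        have : r.support.toFinset = Finset.univ := by
          rw [← Finset.card_eq_iff_eq_univ, List.toFinset_card_of_nodup hpath.support_nodup,
            Walk.length_support, hr, huv]
        rw [hr', ← List.mem_toFinset, this]
        exact Finset.mem_univ w
    · exact hG.isStrongGeodetic_of_geodetic hS h

end Cactus

/-! ### The encoding of an instance -/

theorem List.getD_flatMap_of_length_eq {α β : Type*} (f : α → List β) (d : β) {m : ℕ}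
    (hf : ∀ a, (f a).length = m) (l : List α) (i j : ℕ) (hi : i < l.length) (hj : j < m) :
    (l.flatMap f).getD (m * i + j) d = (f l[i]).getD j d := by
  induction l generalizing i with
  | nil => simp at hi
  | cons a l ih =>
    rw [List.flatMap_cons]
    cases i with
    | zero =>
      rw [Nat.mul_zero, Nat.zero_add, List.getD_append _ _ _ _ (by rwa [hf])]
      rfl
    | succ i =>
      have h : m * (i + 1) + j = m + (m * i + j) := by ring
      rw [List.getD_append_right _ _ _ _ (by rw [hf]; omega), hf, h, Nat.add_sub_cancel_left,
        ih i (by simpa using hi)]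
      rfl

namespace SGRInstance

/-- That the length is a perfect square lets the procedure recover the number of vertices from the
input length alone. -/
theorem length_encode (I : SGRInstance) : I.encode.length = (I.n + 1) * (I.n + 1) := by
  simp only [encode, List.length_append, List.length_replicate, List.length_singleton,
    List.length_flatMap, List.length_map, List.length_finRange, List.map_const', List.sum_replicate,
    smul_eq_mul]
  ring

open Classical in
theorem getD_encode_adj (I : SGRInstance) (u v : Fin I.n) :
    I.encode.getD (I.n + 1 + (I.n * u + v)) false = decide (I.G.Adj u v) := by
  have hlt : I.n * u + v < I.n * I.n := by
    have : I.n * (u + 1) ≤ I.n * I.n := Nat.mul_le_mul_left _ u.2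
    have := v.2
    linarith
  have hlen : ((List.finRange I.n).flatMap fun i =>
      (List.finRange I.n).map fun j => decide (I.G.Adj i j)).length = I.n * I.n := by
    simp [List.length_flatMap]
  rw [encode, List.append_assoc, List.getD_append_right _ _ _ _ (by simp),
    List.getD_append _ _ _ _ (by rw [hlen]; simpa using hlt)]
  simp only [List.length_append, List.length_replicate, List.length_singleton,
    Nat.add_sub_cancel_left]
  rw [List.getD_flatMap_of_length_eq _ _ (m := I.n) (by simp) _ _ _ (by simp) v.2]
  simp

open Classical in
theorem getD_encode_mem (I : SGRInstance) (u : Fin I.n) :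
    I.encode.getD (I.n + 1 + (I.n * I.n + u)) false = decide (u ∈ I.S) := by
  have hlen : (List.replicate I.n true ++ [false] ++ ((List.finRange I.n).flatMap fun i =>
      (List.finRange I.n).map fun j => decide (I.G.Adj i j))).length
      = I.n + 1 + I.n * I.n := by
    simp only [List.length_append, List.length_replicate, List.length_singleton,
      List.length_flatMap, List.length_map, List.length_finRange, List.map_const',
      List.sum_replicate, smul_eq_mul]
  rw [encode, List.getD_append_right _ _ _ _ (by rw [hlen]; omega), hlen, ← Nat.add_assoc,
    Nat.add_sub_cancel_left]
  simp

end SGRInstance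

/-! ### The decision procedure -/

namespace RAM

theorem iterate_induction {f : ℕ → (ℕ → ℕ) → ℕ → ℕ} {m : ℕ → ℕ} {N : ℕ}
    (Inv : ℕ → (ℕ → ℕ) → Prop) (h0 : Inv 0 m)
    (hs : ∀ k < N, ∀ m', Inv k m' → Inv (k + 1) (f k m')) : Inv N (iterate f m N) := by
  have : ∀ k ≤ N, Inv k (iterate f m k) := by
    intro k
    induction k with
    | zero => exact fun _ => h0
    | succ k ih => exact fun hk => hs k hk _ (ih (by omega))
  exact this N le_rfl

namespace Expr

/-- Nonzero iff `a < b`. -/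
def lt (a b : Expr) : Expr := sub b a

/-- Nonzero iff `a = b`. -/
def eq (a b : Expr) : Expr := cond (add (sub a b) (sub b a)) (num 0) (num 1)

/-- Nonzero iff `a` and `b` are. -/
def and (a b : Expr) : Expr := cond a b (num 0)

/-- Nonzero iff `a` is zero. -/
def not (a : Expr) : Expr := cond a (num 0) (num 1)

variable {N : ℕ} {ρ m : ℕ → ℕ}

/-! ### Truth values and arithmetic of the derived expressions -/

theorem eval_lt_ne_zero {a b : Expr} : (lt a b).eval N ρ m ≠ 0 ↔ a.eval N ρ m < b.eval N ρ m := by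
  simp only [lt, eval]; omega

theorem eval_eq_ne_zero {a b : Expr} : (eq a b).eval N ρ m ≠ 0 ↔ a.eval N ρ m = b.eval N ρ m := by
  simp only [eq, eval]
  rcases lt_trichotomy (a.eval N ρ m) (b.eval N ρ m) with h | h | h
  · simp [h.ne, (Nat.sub_pos_of_lt h).ne']
  · simp [h]
  · simp [h.ne', (Nat.sub_pos_of_lt h).ne']

theorem eval_cond {a b c : Expr} {P : Prop} [Decidable P] (h : a.eval N ρ m ≠ 0 ↔ P) :
    (cond a b c).eval N ρ m = if P then b.eval N ρ m else c.eval N ρ m := by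
  rw [eval]
  exact if_congr h rfl rfl

theorem eval_and_ne_zero {a b : Expr} :
    (and a b).eval N ρ m ≠ 0 ↔ a.eval N ρ m ≠ 0 ∧ b.eval N ρ m ≠ 0 := by
  simp only [and, eval]; split_ifs <;> simp_all

theorem eval_not_ne_zero {a : Expr} : (not a).eval N ρ m ≠ 0 ↔ ¬ a.eval N ρ m ≠ 0 := by
  simp only [not, eval]; split_ifs <;> simp_all

theorem eval_add_ne_zero {a b : Expr} :
    (add a b).eval N ρ m ≠ 0 ↔ a.eval N ρ m ≠ 0 ∨ b.eval N ρ m ≠ 0 := by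
  simp only [eval]; omega

theorem eval_sum_ne_zero {x : ℕ} {a : Expr} :
    (sum x a).eval N ρ m ≠ 0 ↔ ∃ i < N, a.eval N (Function.update ρ x i) m ≠ 0 := by
  simp [eval, Finset.sum_eq_zero_iff]

/-- Multiplication is absent from the language; this sum replaces it when one factor is at most the
input length. -/
theorem sum_range_ite_lt {N c y : ℕ} (h : c ≤ N) :
    (∑ j ∈ Finset.range N, if j < c then y else 0) = c * y := by
  rw [← Finset.sum_filter, Finset.sum_const, smul_eq_mul]
  congr 1
  rw [show (Finset.range N).filter (· < c) = Finset.range c by ext; simp; omega, Finset.card_range]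

/-- The number of vertices, if the input length is its successor's square. -/
def order : Expr :=
  sum 10 (cond (lt (sum 11 (cond (lt (var 11) (add (var 10) (num 1))) (add (var 10) (num 1))
    (num 0))) size) (num 1) (num 0))

/-- The expression counts the `i` below `N` whose successor has a square less than `N = (n + 1) * (n
+ 1)`, which are exactly the `i < n`. -/
theorem eval_order {n : ℕ} (hN : N = (n + 1) * (n + 1)) : order.eval N ρ m = n := by
  have h : ∀ i ∈ Finset.range N, (cond (lt (sum 11 (cond (lt (var 11) (add (var 10) (num 1)))
      (add (var 10) (num 1)) (num 0))) size) (num 1) (num 0)).eval N (Function.update ρ 10 i) m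
      = if i < n then 1 else 0 := by
    intro i hi
    have hs : (∑ j ∈ Finset.range N, if j < i + 1 then i + 1 else 0) = (i + 1) * (i + 1) :=
      sum_range_ite_lt (Finset.mem_range.mp hi)
    rw [eval]
    simp only [eval_lt_ne_zero]
    rw [eval]
    conv_lhs => simp only [eval, lt, Function.update_self, ne_eq, Nat.sub_eq_zero_iff_le, not_le,
      Function.update_of_ne (show (10 : ℕ) ≠ 11 by decide)]
    rw [hs, hN]
    congr 1
    rw [eq_iff_iff, Nat.mul_self_lt_mul_self_iff]
    omega
  rw [order, eval, Finset.sum_congr rfl h, sum_range_ite_lt (by rw [hN]; nlinarith), mul_one]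

/-- The product of the number of vertices and a variable. -/
def orderMul (x : ℕ) : Expr := sum 10 (cond (lt (var 10) order) (var x) (num 0))

theorem eval_orderMul {n : ℕ} (hN : N = (n + 1) * (n + 1)) {x : ℕ} (hx : x ≠ 10) :
    (orderMul x).eval N ρ m = n * ρ x := by
  rw [orderMul, eval]
  simp only [eval, lt, eval_order hN, Function.update_self, Function.update_of_ne hx, ne_eq,
    Nat.sub_eq_zero_iff_le, not_le]
  exact sum_range_ite_lt (by rw [hN]; nlinarith)

/-- The square of the number of vertices. -/
def orderSq : Expr := sum 10 (cond (lt (var 10) order) order (num 0))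

theorem eval_orderSq {n : ℕ} (hN : N = (n + 1) * (n + 1)) : orderSq.eval N ρ m = n * n := by
  rw [orderSq, eval]
  simp only [eval, lt, eval_order hN, Function.update_self, ne_eq,
    Nat.sub_eq_zero_iff_le, not_le]
  exact sum_range_ite_lt (by rw [hN]; nlinarith)

/-- Nonzero iff the variables `x` and `y` hold adjacent vertices. -/
def adj (x y : ℕ) : Expr :=
  and (lt (var x) order) <| and (lt (var y) order) <|
    load (add (add order (num 1)) (add (orderMul x) (var y)))

/-- Nonzero iff the variable `x` holds a vertex in the vertex set of the instance. -/
def mem (x : ℕ) : Expr :=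
  and (lt (var x) order) <| load (add (add order (num 1)) (add orderSq (var x)))

/-- The address of the entry `(x, y)` of a table behind the input. -/
def cell (x y : ℕ) : Expr := add size (add (sum 10 (var x)) (var y))

theorem eval_cell {x y : ℕ} (hx : x ≠ 10) :
    (cell x y).eval N ρ m = N + (N * ρ x + ρ y) := by
  simp [cell, eval, Function.update_of_ne hx]

/-- `m` agrees with the initial memory on the input. -/
def HoldsInput (I : SGRInstance) (m : ℕ → ℕ) : Prop :=
  ∀ i < I.encode.length, m i = (input I.encode).mem i

variable {I : SGRInstance}

theorem eval_adj_ne_zero (hm : HoldsInput I m) {x y : ℕ} (hx : x ≠ 10) :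
    (adj x y).eval I.encode.length ρ m ≠ 0 ↔
      ∃ (hu : ρ x < I.n) (hv : ρ y < I.n), I.G.Adj ⟨ρ x, hu⟩ ⟨ρ y, hv⟩ := by
  rw [adj, eval_and_ne_zero, eval_and_ne_zero, eval_lt_ne_zero, eval_lt_ne_zero]
  simp only [eval, eval_order I.length_encode, eval_orderMul I.length_encode hx]
  by_cases hu : ρ x < I.n
  · by_cases hv : ρ y < I.n
    · have hlt : I.n + 1 + (I.n * ρ x + ρ y) < I.encode.length := by
        rw [I.length_encode]
        nlinarith
      have := I.getD_encode_adj ⟨ρ x, hu⟩ ⟨ρ y, hv⟩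
      rw [hm _ hlt, input]
      simp only at this ⊢
      rw [this]
      simp [hu, hv]
    · simp [hv]
  · simp [hu]

theorem eval_mem_ne_zero (hm : HoldsInput I m) {x : ℕ} :
    (mem x).eval I.encode.length ρ m ≠ 0 ↔ ∃ hu : ρ x < I.n, ⟨ρ x, hu⟩ ∈ I.S := by
  rw [mem, eval_and_ne_zero, eval_lt_ne_zero]
  simp only [eval, eval_order I.length_encode, eval_orderSq I.length_encode]
  by_cases hu : ρ x < I.n
  · have hlt : I.n + 1 + (I.n * I.n + ρ x) < I.encode.length := by
      rw [I.length_encode]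
      nlinarith
    have := I.getD_encode_mem ⟨ρ x, hu⟩
    rw [hm _ hlt, input]
    simp only at this ⊢
    rw [this]
    simp [hu]
  · simp [hu]

/-- The new value of the entry `(0, 1)` of the distance table in the round given by the
variable `3`. -/
def relax : Expr :=
  cond (load (cell 0 1)) (load (cell 0 1)) <|
    cond (eq (var 0) (var 1)) (num 1) <|
      -- The round number must be nonzero: in round 0 the empty entries, being 0, would match it.
      cond (and (var 3) (sum 4 (and (adj 4 1) (eq (load (cell 0 4)) (var 3)))))
        (add (var 3) (num 1)) (num 0)

/-- Nonzero iff the vertex set is strong geodetic, given the distance table. -/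
def accept : Expr :=
  add
    (sum 0 (sum 1 (and (mem 0) (and (mem 1) (eq (load (cell 0 1)) order)))))
    (and (lt (num 2) (sum 0 (cond (mem 0) (num 1) (num 0))))
      (not (sum 2 (and (lt (var 2) order) (and (not (mem 2))
        (not (sum 0 (sum 1 (and (mem 0) (and (mem 1)
          -- Entries are successors of distances, so equality in the triangle inequality needs one
          -- extra unit on the right.
          (eq (add (load (cell 0 2)) (load (cell 2 1))) (add (load (cell 0 1)) (num 1)))))))))))))

end Expr

/-- Fills the distance table. -/
def Stmt.distances : Stmt :=
  .times 3 (.times 0 (.times 1 (.store (.cell 0 1) .relax)))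

/-- The entries of the distance table after `k` rounds, for the adjacency relation `A` on the
numbers below `N`: the successor of the distance, where the latter is less than `k`, and `0`
elsewhere. -/
noncomputable def distTable (A : ℕ → ℕ → Prop) (N : ℕ) : ℕ → ℕ → ℕ → ℕ
  | 0, _, _ => 0
  | k + 1, u, v =>
    open Classical in
    if distTable A N k u v ≠ 0 then distTable A N k u v
    else if u = v then 1
    else if k ≠ 0 ∧ ∃ x < N, A x v ∧ distTable A N k u x = k then k + 1 else 0

/-! ### Rounds of the breadth-first search -/

theorem distTable_succ_of_ne_zero {A : ℕ → ℕ → Prop} {N k u v : ℕ}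
    (h : distTable A N k u v ≠ 0) : distTable A N (k + 1) u v = distTable A N k u v := by
  rw [distTable, if_pos h]

theorem distTable_succ_of_eq_zero {A : ℕ → ℕ → Prop} {N k u v : ℕ} (h : distTable A N k u v = 0) :
    distTable A N (k + 1) u v = open Classical in if u = v then 1
      else if k ≠ 0 ∧ ∃ x < N, A x v ∧ distTable A N k u x = k then k + 1 else 0 := by
  rw [distTable, if_neg (not_not.mpr h)]

theorem distTable_self_ne_zero {A : ℕ → ℕ → Prop} {N k u : ℕ} (hk : k ≠ 0) :
    distTable A N k u u ≠ 0 := by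
  obtain ⟨k, rfl⟩ := Nat.exists_eq_succ_of_ne_zero hk
  by_cases h : distTable A N k u u = 0
  · simp [distTable_succ_of_eq_zero h]
  · rwa [distTable_succ_of_ne_zero h]

/-- Round `k ≠ 0` writes only the value `k + 1`, since the diagonal is already filled. Hence the
entries equal to `k`, the only ones the round compares with its neighbours, stay the same, and the
table can be updated in place. -/
theorem distTable_succ_eq_iff {A : ℕ → ℕ → Prop} {N k u v : ℕ} (hk : k ≠ 0) :
    distTable A N (k + 1) u v = k ↔ distTable A N k u v = k := by
  by_cases h : distTable A N k u v = 0
  · rw [distTable_succ_of_eq_zero h, h]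
    have : u ≠ v := by rintro rfl; exact distTable_self_ne_zero hk h
    rw [if_neg this]
    split_ifs <;> omega
  · rw [distTable_succ_of_ne_zero h]

/-- The adjacency relation of an instance, on the natural numbers. -/
def natAdj (I : SGRInstance) (u v : ℕ) : Prop :=
  ∃ (hu : u < I.n) (hv : v < I.n), I.G.Adj ⟨u, hu⟩ ⟨v, hv⟩

theorem _root_.SimpleGraph.Connected.exists_adj_dist_add_one {V : Type*} {G : SimpleGraph V}
    (hG : G.Connected) {u v : V} (huv : u ≠ v) : ∃ x, G.Adj x v ∧ G.dist u x + 1 = G.dist u v := by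
  obtain ⟨p, hp⟩ := hG.exists_walk_length_eq_dist v u
  cases p with
  | nil => exact absurd rfl huv
  | @cons _ x _ h q =>
    refine ⟨x, h.symm, ?_⟩
    have h₁ := SimpleGraph.dist_le q
    have h₂ : G.dist v u ≤ G.dist v x + G.dist x u := hG.dist_triangle
    rw [SimpleGraph.dist_eq_one_iff_adj.mpr h] at h₂
    rw [SimpleGraph.Walk.length_cons] at hp
    rw [SimpleGraph.dist_comm (u := u) (v := x), SimpleGraph.dist_comm (u := u) (v := v)]
    omega

/-- A vertex `v ≠ u` at distance `k` from `u` has a neighbour at distance `k - 1`, whose entry is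
`k`; conversely such a neighbour bounds the distance by the triangle inequality. -/
theorem distTable_eq (I : SGRInstance) (hG : I.G.Connected) {N : ℕ} (hN : I.n ≤ N) (k : ℕ)
    (u v : Fin I.n) : distTable (natAdj I) N k u v =
      if I.G.dist u v < k then I.G.dist u v + 1 else 0 := by
  induction k generalizing v with
  | zero => simp [distTable]
  | succ k ih =>
    by_cases hlt : I.G.dist u v < k
    · rw [distTable_succ_of_ne_zero (by simp [ih, hlt]), ih, if_pos hlt, if_pos (by omega)]
    rw [distTable_succ_of_eq_zero (by simp [ih, hlt])]
    rcases eq_or_ne u v with rfl | huv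
    · simp
    rw [if_neg (fun h => huv (Fin.ext h))]
    have key : (k ≠ 0 ∧ ∃ x < N, natAdj I x v ∧ distTable (natAdj I) N k u x = k) ↔
        I.G.dist u v < k + 1 := by
      constructor
      · rintro ⟨hk, x, -, ⟨hx, hv, hadj⟩, hxk⟩
        have hx' := ih ⟨x, hx⟩
        simp only [hxk] at hx'
        have h₁ : I.G.dist u v ≤ I.G.dist u ⟨x, hx⟩ + I.G.dist ⟨x, hx⟩ v := hG.dist_triangle
        rw [SimpleGraph.dist_eq_one_iff_adj.mpr hadj] at h₁
        split_ifs at hx' <;> omega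
      · intro h
        obtain ⟨x, hadj, hx⟩ := hG.exists_adj_dist_add_one huv
        refine ⟨by omega, x, x.2.trans_le hN, ⟨x.2, v.2, hadj⟩, ?_⟩
        rw [ih, if_pos (by omega)]
        omega
    simp only [key]
    split_ifs <;> omega

-- Halfway through a round the table mixes old and new entries, so each entry is only assumed to
-- have one of the two values. By `distTable_succ_eq_iff` the search for a neighbour does not see
-- the difference.
open RAM.Expr in
theorem eval_relax {I : SGRInstance} {ρ m : ℕ → ℕ} (hm : HoldsInput I m)
    (h0 : ρ 0 < I.encode.length) (h1 : ρ 1 < I.encode.length)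
    (ht : ∀ u < I.encode.length, ∀ v < I.encode.length,
      m (I.encode.length + (I.encode.length * u + v)) =
        distTable (natAdj I) I.encode.length (ρ 3) u v ∨
      m (I.encode.length + (I.encode.length * u + v)) =
        distTable (natAdj I) I.encode.length (ρ 3 + 1) u v) :
    relax.eval I.encode.length ρ m =
      distTable (natAdj I) I.encode.length (ρ 3 + 1) (ρ 0) (ρ 1) := by
  set N := I.encode.length
  have hD : (load (cell 0 1)).eval N ρ m = m (N + (N * ρ 0 + ρ 1)) := by
    rw [eval, eval_cell (by decide)]
  rw [relax, eval, hD]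
  by_cases h : m (N + (N * ρ 0 + ρ 1)) = 0
  · have hz : distTable (natAdj I) N (ρ 3) (ρ 0) (ρ 1) = 0 := by
      by_contra hne
      have := ht _ h0 _ h1
      rw [distTable_succ_of_ne_zero hne, h] at this
      omega
    classical
    have key : (and (var 3) (sum 4 (and (adj 4 1) (eq (load (cell 0 4)) (var 3))))).eval N ρ m ≠ 0 ↔
        (ρ 3 ≠ 0 ∧ ∃ x < N, natAdj I x (ρ 1) ∧ distTable (natAdj I) N (ρ 3) (ρ 0) x = ρ 3) := by
      have hadj : ∀ ρ', (adj 4 1).eval N ρ' m ≠ 0 ↔ natAdj I (ρ' 4) (ρ' 1) :=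
        fun _ => eval_adj_ne_zero hm (by decide)
      simp only [eval_and_ne_zero, eval_eq_ne_zero, eval_sum_ne_zero, hadj]
      simp only [eval, eval_cell (show (0 : ℕ) ≠ 10 by decide), Function.update_self,
        Function.update_of_ne (show (0 : ℕ) ≠ 4 by decide),
        Function.update_of_ne (show (1 : ℕ) ≠ 4 by decide),
        Function.update_of_ne (show (3 : ℕ) ≠ 4 by decide)]
      refine and_congr_right fun h3 => exists_congr fun x => and_congr_right fun hx =>
        and_congr_right fun _ => ?_
      rcases ht _ h0 x hx with h | h
      · rw [h]
      · rw [h, distTable_succ_eq_iff h3]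
    rw [if_neg (not_not.mpr h), distTable_succ_of_eq_zero hz,
      eval_cond (P := ρ 0 = ρ 1) eval_eq_ne_zero, eval_cond key]
    simp only [eval]
  · rw [if_pos h]
    rcases ht _ h0 _ h1 with h' | h'
    · rw [h'] at h
      rw [h', distTable_succ_of_ne_zero h]
    · exact h'

theorem mul_add_inj {N a b u v : ℕ} (hb : b < N) (hv : v < N) (h : N * a + b = N * u + v) :
    a = u ∧ b = v := by
  have h₁ := congrArg (· / N) h
  have h₂ := congrArg (· % N) h
  simp only [Nat.mul_add_div (by omega : 0 < N), Nat.mul_add_mod, Nat.div_eq_of_lt hb,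
    Nat.div_eq_of_lt hv, Nat.mod_eq_of_lt hb, Nat.mod_eq_of_lt hv] at h₁ h₂
  exact ⟨by omega, h₂⟩

open RAM.Expr in
/-- The memory in round `k`, after the entries before `(u, v)` have been updated. -/
def InRound (I : SGRInstance) (k u v : ℕ) (m : ℕ → ℕ) : Prop :=
  HoldsInput I m ∧ ∀ a < I.encode.length, ∀ b < I.encode.length,
    m (I.encode.length + (I.encode.length * a + b)) =
      distTable (natAdj I) I.encode.length (if a < u ∨ a = u ∧ b < v then k + 1 else k) a b

open RAM.Expr in
theorem InRound.store {I : SGRInstance} {ρ m : ℕ → ℕ} (h : InRound I (ρ 3) (ρ 0) (ρ 1) m)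
    (h0 : ρ 0 < I.encode.length) (h1 : ρ 1 < I.encode.length) :
    InRound I (ρ 3) (ρ 0) (ρ 1 + 1)
      ((Stmt.store (cell 0 1) relax).run I.encode.length ρ m) := by
  obtain ⟨hm, ht⟩ := h
  rw [Stmt.run, eval_cell (by decide), eval_relax hm h0 h1 (fun u hu v hv => by
    rw [ht u hu v hv]; split_ifs <;> simp)]
  refine ⟨fun i hi => ?_, fun a ha b hb => ?_⟩
  · rw [Function.update_of_ne (by omega), hm i hi]
  · by_cases hab : a = ρ 0 ∧ b = ρ 1
    · obtain ⟨rfl, rfl⟩ := hab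
      rw [Function.update_self, if_pos (by omega)]
    · rw [Function.update_of_ne (fun he => hab (mul_add_inj hb h1 (by omega))), ht a ha b hb]
      congr 1
      exact if_congr (by omega) rfl rfl

/-- Three nested invariants, one for each loop. A finished row `u` up to column `N` is the same as
row `u + 1` at column 0, and all rows finished is the start of round `k + 1`. -/
theorem inRound_distances (I : SGRInstance) (ρ : ℕ → ℕ) :
    InRound I I.encode.length 0 0
      (Stmt.distances.run I.encode.length ρ (input I.encode).mem) := by
  rw [Stmt.distances, Stmt.run]
  refine iterate_induction (fun k m => InRound I k 0 0 m) ⟨fun _ _ => rfl, fun a _ b _ => ?_⟩ ?_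
  · simp [distTable, input]
  intro k hk m h
  rw [Stmt.run]
  have key := iterate_induction (N := I.encode.length) (m := m)
    (f := fun i m => (Stmt.times 1 (.store (.cell 0 1) .relax)).run I.encode.length
      (Function.update (Function.update ρ 3 k) 0 i) m)
    (fun u m => InRound I k u 0 m) h fun u hu m h => ?_
  · refine ⟨key.1, fun a ha b hb => ?_⟩
    rw [key.2 a ha b hb]
    simp [ha]
  rw [Stmt.run]
  have key := iterate_induction (N := I.encode.length) (m := m)
    (f := fun i m => (Stmt.store (.cell 0 1) .relax).run I.encode.length
      (Function.update (Function.update (Function.update ρ 3 k) 0 u) 1 i) m)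
    (fun v m => InRound I k u v m) h fun v hv m h => ?_
  · refine ⟨key.1, fun a ha b hb => ?_⟩
    rw [key.2 a ha b hb]
    congr 1
    exact if_congr (by omega) rfl rfl
  · exact InRound.store (ρ := Function.update (Function.update (Function.update ρ 3 k) 0 u) 1 v)
      (by simpa using h) (by simpa using hu) (by simpa using hv)

/-- Distances in a connected graph are less than the number of vertices, which is less than the
number of rounds, so every entry has been filled. -/
theorem distances_run (I : SGRInstance) (hG : I.G.Connected) (ρ : ℕ → ℕ) (u v : Fin I.n) :
    Stmt.distances.run I.encode.length ρ (input I.encode).mem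
      (I.encode.length + (I.encode.length * u + v)) = I.G.dist u v + 1 := by
  have hn : I.n < I.encode.length := by
    rw [I.length_encode]; nlinarith
  rw [(inRound_distances I ρ).2 u (u.2.trans hn) v (v.2.trans hn)]
  simp only [Nat.not_lt_zero, and_false, or_false, if_false]
  rw [distTable_eq I hG hn.le, if_pos]
  obtain ⟨p, hp, hlen⟩ := hG.exists_path_of_dist u v
  have := hp.length_lt
  rw [Fintype.card_fin] at this
  omega

open RAM.Expr in
theorem eval_accept {I : SGRInstance} {ρ m : ℕ → ℕ} (hm : HoldsInput I m)
    (ht : ∀ u v : Fin I.n,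
      m (I.encode.length + (I.encode.length * u + v)) = I.G.dist u v + 1) :
    accept.eval I.encode.length ρ m ≠ 0 ↔
      (∃ u ∈ I.S, ∃ v ∈ I.S, I.G.dist u v + 1 = I.n) ∨ (3 ≤ I.S.card ∧ ∀ w ∉ I.S,
        ∃ u ∈ I.S, ∃ v ∈ I.S, I.G.dist u w + I.G.dist w v = I.G.dist u v) := by
  have hn : I.n < I.encode.length := by
    rw [I.length_encode]; nlinarith
  -- Translates the search over numbers below the input length into quantifiers over `S`; it serves
  -- both disjuncts.
  have hpairs : ∀ Q : ℕ → ℕ → Prop, (∃ i < I.encode.length, ∃ j < I.encode.length,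
      (∃ hu : i < I.n, ⟨i, hu⟩ ∈ I.S) ∧ (∃ hv : j < I.n, ⟨j, hv⟩ ∈ I.S) ∧ Q i j) ↔
      ∃ u ∈ I.S, ∃ v ∈ I.S, Q u v := by
    intro Q
    constructor
    · rintro ⟨i, -, j, -, ⟨hi, hi'⟩, ⟨hj, hj'⟩, h⟩
      exact ⟨_, hi', _, hj', h⟩
    · rintro ⟨u, hu, v, hv, h⟩
      exact ⟨u, u.2.trans hn, v, v.2.trans hn, ⟨u.2, hu⟩, ⟨v.2, hv⟩, h⟩
  have hcard : (sum 0 (cond (mem 0) (num 1) (num 0))).eval I.encode.length ρ m = I.S.card := by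
    rw [eval]
    have : ∀ i, (cond (mem 0) (num 1) (num 0)).eval I.encode.length (Function.update ρ 0 i) m =
        open Classical in if ∃ hu : i < I.n, (⟨i, hu⟩ : Fin I.n) ∈ I.S then 1 else 0 := by
      intro i
      rw [eval]
      simp only [eval_mem_ne_zero hm, Function.update_self, eval]
    classical
    simp only [this]
    rw [Finset.sum_boole, Nat.cast_id, ← Finset.card_map Fin.valEmbedding]
    congr 1
    ext i
    simp only [Finset.mem_filter, Finset.mem_range, Finset.mem_map, Fin.valEmbedding_apply]
    constructor
    · rintro ⟨-, hi, h⟩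
      exact ⟨_, h, rfl⟩
    · rintro ⟨u, hu, rfl⟩
      exact ⟨u.2.trans hn, u.2, hu⟩
  rw [accept, eval_add_ne_zero]
  simp only [eval_and_ne_zero, eval_not_ne_zero, eval_sum_ne_zero, eval_lt_ne_zero, hcard,
    eval_eq_ne_zero, eval_mem_ne_zero hm, eval_order I.length_encode]
  simp only [eval, eval_cell (show (0 : ℕ) ≠ 10 by decide),
    eval_cell (show (2 : ℕ) ≠ 10 by decide), Function.update_self,
    Function.update_of_ne (show (0 : ℕ) ≠ 1 by decide),
    Function.update_of_ne (show (2 : ℕ) ≠ 0 by decide),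
    Function.update_of_ne (show (2 : ℕ) ≠ 1 by decide)]
  rw [hpairs fun i j => m (I.encode.length + (I.encode.length * i + j)) = I.n]
  simp only [hpairs fun i j => _ + _ = _ + 1]
  refine or_congr (by simp only [ht]) (and_congr Iff.rfl ?_)
  constructor
  · intro h w hw
    by_contra hcon
    refine h ⟨w, w.2.trans hn, w.2, fun ⟨_, hw'⟩ => hw hw', fun ⟨u, hu, v, hv, he⟩ => hcon
      ⟨u, hu, v, hv, ?_⟩⟩
    simp only [ht] at he
    omega
  · rintro h ⟨i, -, hi, hiS, hcon⟩
    obtain ⟨u, hu, v, hv, he⟩ := h ⟨i, hi⟩ (fun h => hiS ⟨hi, h⟩)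
    refine hcon ⟨u, hu, v, hv, ?_⟩
    have h₁ := ht u ⟨i, hi⟩
    have h₂ := ht ⟨i, hi⟩ v
    simp only at h₁ h₂
    rw [h₁, h₂, ht]
    omega

end RAM

theorem mainTheorem12 :
    RAM.SolvableInPolyTime SGRInstance.encode
      (fun I => IsCactus I.G) (fun I => IsStrongGeodetic I.G I.S) := by
  refine RAM.solvableInPolyTime_of_stmt RAM.Stmt.distances RAM.Expr.accept fun I hI => ?_
  rw [RAM.eval_accept (RAM.inRound_distances I _).1 (RAM.distances_run I hI.1 _),
    hI.isStrongGeodetic_iff, Fintype.card_fin]
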